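/- **Theorem 5.1.** Let $F$ be a field of characteristic $2$ with a rank $2$ valuation $\mathfrak v$ whose value group $\Gamma=\mathfrak v(F^\times)$ is isomorphic, as a group, to $\mathbb Z\times\mathbb Z$ (the rank of $\mathfrak v$ is the number of convex subgroups of the ordered group $\Gamma$ other than $\Gamma$ itself). For $q\in F^\times$ let $\overline{\mathfrak v}(q)$ be the class of $\mathfrak v(q)$ in the $\mathbb F_2$-vector space $\Gamma/2\Gamma$. Let $\alpha,\beta\in F^\times$ have negative values, $\mathfrak v(\alpha)<0$ and $\mathfrak v(\beta)<0$, and suppose that $\overline{\mathfrak v}(\alpha)$ and $\overline{\mathfrak v}(\beta)$ are linearly independent over $\mathbb F_2$. For $a\in F$ and $b\in F^\times$ write $$(b,a]_{2,F}=F\langle x,y : x^2+x=a,\ y^2=b,\ yxy^{-1}=x+1\rangle$$ for the associated quaternion algebra. Then the three quaternion algebras $$Q_1=(\beta,\alpha]_{2,F},\qquad Q_2=(\alpha,\beta]_{2,F},\qquad Q_3=(\beta,\alpha\beta]_{2,F}$$ have no common inseparable quadratic splitting field: there is no inseparable field extension $K/F$ of degree $2$ such that $K\otimes_F Q_i\cong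 M_2(K)$ as $K$-algebras for all $i\in\{1,2,3\}$. -/

import Mathlib

open scoped TensorProduct

/-- The rank of a linearly ordered abelian group: the number of its convex subgroups other than
the whole group. The rank of a valuation is the rank of its value group. -/
noncomputable def convexRank (G : Type*) [AddCommGroup G] [LinearOrder G] : ℕ∞ :=
  {H : AddSubgroup G | (H : Set G).OrdConnected ∧ H ≠ ⊤}.encard

/-- The value of a nonzero element, as an element of the value group `G` (the value `⊤` is taken
only at `0`). -/
noncomputable def unitValue {F G : Type*} [Field F] [AddCommGroup G] [LinearOrder G]
    [IsOrderedAddMonoid G] (v : AddValuation F (WithTop G)) (q : Fˣ) : G :=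
  (v (q : F)).untop (v.ne_top_iff.2 q.ne_zero)

/-- The class of the value of a nonzero element in `G / 2G`, a vector space over `𝔽₂`. -/
noncomputable def valueClass {F G : Type*} [Field F] [AddCommGroup G] [LinearOrder G]
    [IsOrderedAddMonoid G] (v : AddValuation F (WithTop G)) (q : Fˣ) : ModN G 2 :=
  ModN.mkQ 2 (unitValue v q)

/-- The quaternion algebra `(b, a]` over a field `F` of characteristic 2, that is, the `F`-algebra
with generators `x`, `y` and relations `x² + x = a`, `y² = b`, `y x y⁻¹ = x + 1`. In Mathlib's
`QuaternionAlgebra F a 1 b` one has `i² = a + i`, `j² = b`, `j i = j - i j`, and `x = i`, `y = j`.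
The theorem `QuatSymbol.existsUnique_algHom` is the presentation. -/
abbrev QuatSymbol {F : Type*} [Field F] (b : Fˣ) (a : F) : Type _ :=
  QuaternionAlgebra F a 1 (b : F)

namespace QuatSymbol

/-- The generator `x`. -/
def x {F : Type*} [Field F] (b : Fˣ) (a : F) : QuatSymbol b a := ⟨0, 1, 0, 0⟩

/-- The generator `y`. -/
def y {F : Type*} [Field F] (b : Fˣ) (a : F) : QuatSymbol b a := ⟨0, 0, 1, 0⟩

theorem x_rel {F : Type*} [Field F] [CharP F 2] (b : Fˣ) (a : F) :
    x b a ^ 2 + x b a = algebraMap F (QuatSymbol b a) a := by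
  ext <;> simp [x, pow_two, QuaternionAlgebra.algebraMap_eq, CharTwo.add_self_eq_zero]

theorem y_rel {F : Type*} [Field F] (b : Fˣ) (a : F) :
    y b a ^ 2 = algebraMap F (QuatSymbol b a) (b : F) := by
  ext <;> simp [y, pow_two, QuaternionAlgebra.algebraMap_eq]

theorem y_mul_x {F : Type*} [Field F] [CharP F 2] (b : Fˣ) (a : F) :
    y b a * x b a = (x b a + 1) * y b a := by
  ext <;> simp [x, y, CharTwo.neg_eq]

/-- `(b, a]` is the universal `F`-algebra on two elements satisfying the relations. (The relation
`Y X = (X + 1) Y` is `Y X Y⁻¹ = X + 1`, as `Y` is a unit because `Y² = b ≠ 0`.) -/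
theorem existsUnique_algHom {F : Type*} [Field F] [CharP F 2] (b : Fˣ) (a : F)
    {A : Type*} [Ring A] [Algebra F A] (X Y : A)
    (hX : X ^ 2 + X = algebraMap F A a) (hY : Y ^ 2 = algebraMap F A (b : F))
    (hYX : Y * X = (X + 1) * Y) :
    ∃! f : QuatSymbol b a →ₐ[F] A, f (x b a) = X ∧ f (y b a) = Y := by
  have two : ∀ z : A, z + z = 0 := fun z => by
    rw [← two_smul F z, CharTwo.two_eq_zero, zero_smul]
  have neg : ∀ z : A, -z = z := fun z => neg_eq_of_add_eq_zero_left (two z)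
  let B : QuaternionAlgebra.Basis A a 1 (b : F) :=
    { i := X, j := Y, k := X * Y
      i_mul_i := by
        rw [← Algebra.algebraMap_eq_smul_one, ← hX, one_smul, add_assoc, two, add_zero, pow_two]
      j_mul_j := by rw [← Algebra.algebraMap_eq_smul_one, ← hY, pow_two]
      i_mul_j := rfl
      j_mul_i := by rw [hYX, one_smul, sub_eq_add_neg, neg, add_mul, one_mul, add_comm] }
  refine ⟨B.liftHom, ⟨?_, ?_⟩, ?_⟩
  · simp [QuaternionAlgebra.Basis.lift, x, B]
  · simp [QuaternionAlgebra.Basis.lift, y, B]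
  · rintro g ⟨hgx, hgy⟩
    apply QuaternionAlgebra.hom_ext
    · rw [show (QuaternionAlgebra.Basis.self F).i = x b a from rfl, hgx]
      simp [QuaternionAlgebra.Basis.lift, x, B]
    · rw [show (QuaternionAlgebra.Basis.self F).j = y b a from rfl, hgy]
      simp [QuaternionAlgebra.Basis.lift, y, B]

end QuatSymbol

/-- The field extension `K` of `F` splits the quaternion algebra `Q` over `F`: the `K`-algebra
`K ⊗ Q` is isomorphic to the algebra of `2 × 2` matrices over `K`. -/
def IsSplitBy (F Q K : Type*) [Field F] [Ring Q] [Algebra F Q] [Field K] [Algebra F K] : Prop :=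
  Nonempty (K ⊗[F] Q ≃ₐ[K] Matrix (Fin 2) (Fin 2) K)

/-- `K` is an inseparable quadratic field extension of `F`. -/
def IsInsepQuadratic (F K : Type*) [Field F] [Field K] [Algebra F K] : Prop :=
  Module.finrank F K = 2 ∧ ¬ Algebra.IsSeparable F K

/-! An inseparable quadratic extension is `F(√c)` with `c` a nonsquare. The norm forms of the three
algebras are anisotropic, so splitting by `F(√c)` puts a square root of `c` into each algebra, and
`c` is represented by the pure part of each norm form. In characteristic 2, adding two of these
representations equates a value of the form ⟨1, α, β, αβ⟩ in squares with a sum of two cross terms.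
The four coefficients have distinct classes in Γ/2Γ, so nothing cancels on the left and every square
term has value at least that of the sum (`squareDominated_of_linearIndependent`). The cross term of
least value among the three therefore bounds two square terms from below; since α, β and αβ have
negative values, this forces it to vanish (`cross_eq_zero`). Then all cross terms vanish and `c` is
a square (`SquareDominated.isSquare_of_represented`). -/

/-! ### Value classes modulo 2Γ -/

section ValueClass

variable {F Γ : Type*} [Field F] [AddCommGroup Γ] [LinearOrder Γ] [IsOrderedAddMonoid Γ]
  (v : AddValuation F (WithTop Γ))

theorem coe_unitValue (q : Fˣ) : ((unitValue v q : Γ) : WithTop Γ) = v (q : F) :=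
  WithTop.coe_untop _ _

theorem unitValue_mul (p q : Fˣ) : unitValue v (p * q) = unitValue v p + unitValue v q := by
  apply WithTop.coe_injective
  rw [WithTop.coe_add, coe_unitValue, coe_unitValue, coe_unitValue, Units.val_mul, v.map_mul]

theorem val_mul_neg {a b : F} (ha : v a < 0) (hb : v b < 0) : v (a * b) < 0 := by
  rw [v.map_mul]
  exact (add_le_of_nonpos_left ha.le).trans_lt hb

theorem valueClass_mul (p q : Fˣ) : valueClass v (p * q) = valueClass v p + valueClass v q := by
  rw [valueClass, unitValue_mul, map_add, valueClass, valueClass]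

theorem valueClass_add_self (p : Fˣ) : valueClass v p + valueClass v p = 0 := by
  rw [← two_smul (ZMod 2), show (2 : ZMod 2) = 0 from rfl, zero_smul]

theorem valueClass_one : valueClass v 1 = 0 := by
  simpa using valueClass_mul v 1 1

/-- A nonzero square factor does not change the class modulo 2Γ, so the values can agree only when
both terms are zero. -/
theorem val_mul_sq_eq_top {d e : Fˣ} (h : valueClass v d ≠ valueClass v e) {x y : F}
    (hxy : v (d * x ^ 2) = v (e * y ^ 2)) : v (d * x ^ 2) = ⊤ := by
  by_cases hx : x = 0
  · simp [hx]
  by_cases hy : y = 0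
  · rw [hxy]; simp [hy]
  refine absurd ?_ h
  have key : unitValue v (d * (Units.mk0 x hx * Units.mk0 x hx)) =
      unitValue v (e * (Units.mk0 y hy * Units.mk0 y hy)) := by
    apply WithTop.coe_injective
    rw [coe_unitValue, coe_unitValue]
    simpa [pow_two] using hxy
  have := congrArg (ModN.mkQ 2) key
  change valueClass v _ = valueClass v _ at this
  simpa only [valueClass_mul, valueClass_add_self, add_zero] using this

end ValueClass

/-! ### Square terms against cross terms -/

section Domination

variable {F Γ : Type*} [Field F] [AddCommGroup Γ] [LinearOrder Γ] [IsOrderedAddMonoid Γ]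
  (v : AddValuation F (WithTop Γ))

/-- The hypothesis means distinct values, except that both terms may be zero; this spares case
splits on vanishing coordinates. -/
theorem val_add_eq_min {x y : F} (h : v x = v y → v x = ⊤) : v (x + y) = min (v x) (v y) := by
  by_cases hxy : v x = v y
  · have hx := h hxy
    have hy := hxy ▸ hx
    have := v.map_add x y
    simpa [hx, hy] using this
  · exact v.map_add_of_distinct_val hxy

theorem val_add_four_eq_min {x y z w : F} (hxy : v x = v y → v x = ⊤)
    (hxz : v x = v z → v x = ⊤) (hxw : v x = v w → v x = ⊤) (hyz : v y = v z → v y = ⊤)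
    (hyw : v y = v w → v y = ⊤) (hzw : v z = v w → v z = ⊤) :
    v (x + y + (z + w)) = min (min (v x) (v y)) (min (v z) (v w)) := by
  rw [val_add_eq_min, val_add_eq_min v hxy, val_add_eq_min v hzw]
  rw [val_add_eq_min v hxy, val_add_eq_min v hzw]
  intro h
  rcases min_choice (v x) (v y) with h1 | h1 <;> rcases min_choice (v z) (v w) with h2 | h2 <;>
    rw [h1, h2] at h <;> rw [h1]
  exacts [hxz h, hxw h, hyz h, hyw h]

/-- The form `⟨1, a, b, ab⟩` in squares has no cancellation of values. -/
def SquareDominated (a b : F) : Prop :=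
  ∀ x y z w : F,
    v (x ^ 2 + a * y ^ 2 + (b * z ^ 2 + a * b * w ^ 2)) ≤ v (x ^ 2) ∧
    v (x ^ 2 + a * y ^ 2 + (b * z ^ 2 + a * b * w ^ 2)) ≤ v (a * y ^ 2) ∧
    v (x ^ 2 + a * y ^ 2 + (b * z ^ 2 + a * b * w ^ 2)) ≤ v (b * z ^ 2) ∧
    v (x ^ 2 + a * y ^ 2 + (b * z ^ 2 + a * b * w ^ 2)) ≤ v (a * b * w ^ 2)

variable {v}

/-- Independence over 𝔽₂ makes the classes of 1, α, β, αβ pairwise distinct, so the value of the sum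
is the minimum of the four values. -/
theorem squareDominated_of_linearIndependent {α β : Fˣ}
    (h : LinearIndependent (ZMod 2) ![valueClass v α, valueClass v β]) :
    SquareDominated v (α : F) (β : F) := by
  have hp := LinearIndependent.pair_iff.1 h
  have hα : valueClass v α ≠ 0 := fun h0 => by simpa using hp 1 0 (by simp [h0])
  have hβ : valueClass v β ≠ 0 := fun h0 => by simpa using hp 0 1 (by simp [h0])
  have hs : valueClass v α + valueClass v β ≠ 0 := fun h0 => by simpa using hp 1 1 (by simp [h0])
  have hne : valueClass v α ≠ valueClass v β := fun h0 => by
    rw [h0, valueClass_add_self] at hs; exact hs rfl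
  intro x y z w
  have key := val_add_four_eq_min v (x := (1 : Fˣ) * x ^ 2) (y := α * y ^ 2) (z := β * z ^ 2)
    (w := (α * β : Fˣ) * w ^ 2)
    (val_mul_sq_eq_top v (by rw [valueClass_one]; exact hα.symm))
    (val_mul_sq_eq_top v (by rw [valueClass_one]; exact hβ.symm))
    (val_mul_sq_eq_top v (by rw [valueClass_one, valueClass_mul]; exact hs.symm))
    (val_mul_sq_eq_top v hne)
    (val_mul_sq_eq_top v (by rw [valueClass_mul]; simpa using hβ))
    (val_mul_sq_eq_top v (by rw [valueClass_mul]; simpa using hα))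
  simp only [Units.val_one, one_mul, Units.val_mul] at key
  rw [key]
  simp

theorem SquareDominated.symm {a b : F} (h : SquareDominated v a b) : SquareDominated v b a := by
  intro x y z w
  have := h x z y w
  rw [show x ^ 2 + a * z ^ 2 + (b * y ^ 2 + a * b * w ^ 2) =
    x ^ 2 + b * y ^ 2 + (a * z ^ 2 + b * a * w ^ 2) by ring, mul_comm a b] at this
  tauto

/-- Since `ab · b` equals `a` up to a square, the new form is the old one with its terms permuted.
-/
theorem SquareDominated.mul_left {a b : F} (h : SquareDominated v a b) :
    SquareDominated v (a * b) b := by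
  intro x y z w
  have := h x (b * w) z y
  rw [show x ^ 2 + a * (b * w) ^ 2 + (b * z ^ 2 + a * b * y ^ 2) =
    x ^ 2 + a * b * y ^ 2 + (b * z ^ 2 + a * b * b * w ^ 2) by ring,
    show a * (b * w) ^ 2 = a * b * b * w ^ 2 by ring] at this
  tauto

/-- A cross term `b x y` cannot be dominated by both of `b x²` and `a b y²` when `v a < 0`. -/
theorem cross_eq_zero {a b x y : F} (ha : v a < 0) (h₁ : v (b * x * y) ≤ v (b * x ^ 2))
    (h₂ : v (b * x * y) ≤ v (a * b * y ^ 2)) : b * x * y = 0 := by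
  by_contra h
  obtain ⟨⟨hb, hx⟩, hy⟩ : (b ≠ 0 ∧ x ≠ 0) ∧ y ≠ 0 := by simpa [not_or] using h
  have ha0 : a ≠ 0 := by rintro rfl; simp at ha
  have hav : unitValue v (Units.mk0 a ha0) < 0 := by
    rw [← WithTop.coe_lt_coe, coe_unitValue]; exact ha
  have e₁ : unitValue v (Units.mk0 b hb * Units.mk0 x hx * Units.mk0 y hy) ≤
      unitValue v (Units.mk0 b hb * (Units.mk0 x hx * Units.mk0 x hx)) := by
    rw [← WithTop.coe_le_coe, coe_unitValue, coe_unitValue]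
    simpa [pow_two] using h₁
  have e₂ : unitValue v (Units.mk0 b hb * Units.mk0 x hx * Units.mk0 y hy) ≤
      unitValue v (Units.mk0 a ha0 * Units.mk0 b hb * (Units.mk0 y hy * Units.mk0 y hy)) := by
    rw [← WithTop.coe_le_coe, coe_unitValue, coe_unitValue]
    simpa [pow_two] using h₂
  simp only [unitValue_mul] at e₁ e₂
  -- Adding `e₁` and `e₂` and cancelling twice the value of `b * x * y` leaves `0 ≤ v a`.
  grind

theorem eq_zero_of_sq_val_top {a x : F} (ha : a ≠ 0) (h : v 0 ≤ v (a * x ^ 2)) : x = 0 := by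
  have : a * x ^ 2 = 0 := (v.top_iff).1 (top_le_iff.1 (v.map_zero ▸ h))
  simpa [ha] using this

/-- The norm form of `(b, a]` is anisotropic. -/
theorem SquareDominated.anisotropic [CharP F 2] {a b : F} (h : SquareDominated v a b)
    (ha : v a < 0) (ha0 : a ≠ 0) (hb0 : b ≠ 0) {x y z w : F}
    (h0 : x ^ 2 + x * y + a * y ^ 2 + b * (z ^ 2 + z * w + a * w ^ 2) = 0) :
    x = 0 ∧ y = 0 ∧ z = 0 ∧ w = 0 := by
  have two : (2 : F) = 0 := CharTwo.two_eq_zero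
  -- The factor 1 gives the first cross term the shape required by `cross_eq_zero`.
  have hs : x ^ 2 + a * y ^ 2 + (b * z ^ 2 + a * b * w ^ 2) = 1 * x * y + b * z * w := by
    linear_combination h0 - (x * y + b * z * w) * two
  obtain ⟨h₁, h₂, h₃, h₄⟩ := h x y z w
  have hm := v.map_add (1 * x * y) (b * z * w)
  rw [hs] at h₁ h₂ h₃ h₄
  have hzero : 1 * x * y = 0 ∧ b * z * w = 0 := by
    rcases le_total (v (1 * x * y)) (v (b * z * w)) with hle | hle
    · rw [min_eq_left hle] at hm
      have : 1 * x * y = 0 := cross_eq_zero ha (by simpa using hm.trans h₁)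
        (by simpa using hm.trans h₂)
      rw [this, v.map_zero, top_le_iff, v.top_iff] at hle
      exact ⟨this, hle⟩
    · rw [min_eq_right hle] at hm
      have : b * z * w = 0 := cross_eq_zero ha (hm.trans h₃) (hm.trans h₄)
      rw [this, v.map_zero, top_le_iff, v.top_iff] at hle
      exact ⟨hle, this⟩
  rw [hzero.1, hzero.2, add_zero] at h₁ h₂ h₃ h₄
  exact ⟨eq_zero_of_sq_val_top one_ne_zero (by simpa using h₁), eq_zero_of_sq_val_top ha0 h₂,
    eq_zero_of_sq_val_top hb0 h₃, eq_zero_of_sq_val_top (mul_ne_zero ha0 hb0) h₄⟩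

/-- An element represented by the pure parts of the norm forms of `(b, a]`, `(a, b]` and `(b, ab]`
is a square. -/
theorem SquareDominated.isSquare_of_represented [CharP F 2] {a b c : F}
    (h : SquareDominated v a b) (ha : v a < 0) (hb : v b < 0) (ha0 : a ≠ 0) (hb0 : b ≠ 0)
    {u₁ w₁ z₁ u₂ w₂ z₂ u₃ w₃ z₃ : F}
    (h₁ : c = u₁ ^ 2 + b * (w₁ ^ 2 + w₁ * z₁ + a * z₁ ^ 2))
    (h₂ : c = u₂ ^ 2 + a * (w₂ ^ 2 + w₂ * z₂ + b * z₂ ^ 2))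
    (h₃ : c = u₃ ^ 2 + b * (w₃ ^ 2 + w₃ * z₃ + a * b * z₃ ^ 2)) : IsSquare c := by
  have two : (2 : F) = 0 := CharTwo.two_eq_zero
  have hab : v (a * b) < 0 := val_mul_neg v ha hb
  have e₁₂ : (u₁ + u₂) ^ 2 + a * w₂ ^ 2 + (b * w₁ ^ 2 + a * b * (z₁ + z₂) ^ 2) =
      b * w₁ * z₁ + a * w₂ * z₂ := by
    linear_combination -h₁ - h₂ + (c + u₁ * u₂ + a * b * z₁ * z₂ - b * w₁ * z₁ - a * w₂ * z₂) * two
  have e₁₃ : (u₁ + u₃) ^ 2 + a * (b * z₃) ^ 2 + (b * (w₁ + w₃) ^ 2 + a * b * z₁ ^ 2) =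
      b * w₁ * z₁ + b * w₃ * z₃ := by
    linear_combination -h₁ - h₃ + (c + u₁ * u₃ + b * w₁ * w₃ - b * w₁ * z₁ - b * w₃ * z₃) * two
  have e₂₃ : (u₂ + u₃) ^ 2 + a * (w₂ + b * z₃) ^ 2 + (b * w₃ ^ 2 + a * b * z₂ ^ 2) =
      a * w₂ * z₂ + b * w₃ * z₃ := by
    linear_combination -h₂ - h₃ + (c + u₂ * u₃ + a * b * w₂ * z₃ - a * w₂ * z₂ - b * w₃ * z₃) * two
  obtain ⟨-, p₂, p₃, p₄⟩ := h (u₁ + u₂) w₂ w₁ (z₁ + z₂)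
  obtain ⟨-, q₂, q₃, q₄⟩ := h (u₁ + u₃) (b * z₃) (w₁ + w₃) z₁
  obtain ⟨-, r₂, r₃, r₄⟩ := h (u₂ + u₃) (w₂ + b * z₃) w₃ z₂
  rw [e₁₂] at p₂ p₃ p₄
  rw [e₁₃] at q₂ q₃ q₄
  rw [e₂₃] at r₂ r₃ r₄
  have m₁₂ := v.map_add (b * w₁ * z₁) (a * w₂ * z₂)
  have m₁₃ := v.map_add (b * w₁ * z₁) (b * w₃ * z₃)
  have m₂₃ := v.map_add (a * w₂ * z₂) (b * w₃ * z₃)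
  have top {x y : F} (hxy : v x ≤ v y) (hx : x = 0) : y = 0 := by
    rwa [hx, v.map_zero, top_le_iff, v.top_iff] at hxy
  have hzero : b * w₁ * z₁ = 0 ∧ a * w₂ * z₂ = 0 ∧ b * w₃ * z₃ = 0 := by
    -- Each cross term occurs in two of the three sums, and the least one bounds both from below.
    -- Each of these sums supplies one of the two bounds that `cross_eq_zero` needs.
    have hcase : (v (b * w₁ * z₁) ≤ v (a * w₂ * z₂) ∧ v (b * w₁ * z₁) ≤ v (b * w₃ * z₃)) ∨
        (v (a * w₂ * z₂) ≤ v (b * w₁ * z₁) ∧ v (a * w₂ * z₂) ≤ v (b * w₃ * z₃)) ∨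
        (v (b * w₃ * z₃) ≤ v (b * w₁ * z₁) ∧ v (b * w₃ * z₃) ≤ v (a * w₂ * z₂)) := by
      grind
    rcases hcase with ⟨l, l'⟩ | ⟨l, l'⟩ | ⟨l, l'⟩
    · rw [min_eq_left l] at m₁₂
      rw [min_eq_left l'] at m₁₃
      have := cross_eq_zero ha (m₁₂.trans p₃) (m₁₃.trans q₄)
      exact ⟨this, top l this, top l' this⟩
    · rw [min_eq_right l] at m₁₂
      rw [min_eq_left l'] at m₂₃
      have := cross_eq_zero hb (m₁₂.trans p₂) (mul_comm a b ▸ m₂₃.trans r₄)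
      exact ⟨top l this, this, top l' this⟩
    · rw [min_eq_right l] at m₁₃
      rw [min_eq_right l'] at m₂₃
      have := cross_eq_zero hab (m₂₃.trans r₃)
        ((show a * (b * z₃) ^ 2 = a * b * b * z₃ ^ 2 by ring) ▸ m₁₃.trans q₂)
      exact ⟨top l this, top l' this, this⟩
  rw [hzero.1, hzero.2.1, add_zero] at p₃
  rw [hzero.1, hzero.2.2, add_zero] at q₄
  have hw : w₁ = 0 := eq_zero_of_sq_val_top hb0 p₃
  have hz : z₁ = 0 := eq_zero_of_sq_val_top (mul_ne_zero ha0 hb0) q₄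
  exact ⟨u₁, by rw [h₁, hw, hz]; ring⟩

end Domination

/-! ### Inseparable quadratic extensions and splitting -/

/-- The minimal polynomial of an inseparable element is quadratic with zero derivative, so it has no
linear term. -/
theorem IsInsepQuadratic.exists_sq {F K : Type*} [Field F] [CharP F 2] [Field K] [Algebra F K]
    (h : IsInsepQuadratic F K) :
    ∃ (c : F) (s : K), ¬ IsSquare c ∧ s ^ 2 = algebraMap F K c ∧
      LinearIndependent F ![(1 : K), s] := by
  obtain ⟨hfin, hsep⟩ := h
  have : FiniteDimensional F K := Module.finite_of_finrank_pos (by omega)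
  obtain ⟨s, hs⟩ : ∃ s : K, ¬ IsSeparable F s := by
    by_contra! hall
    exact hsep ⟨hall⟩
  have hint : IsIntegral F s := IsIntegral.of_finite F s
  have hsF : s ∉ (algebraMap F K).range := by
    rintro ⟨d, rfl⟩
    exact hs (isSeparable_algebraMap d)
  have hder : Polynomial.derivative (minpoly F s) = 0 := by
    by_contra hne
    exact hs ((Polynomial.separable_iff_derivative_ne_zero (minpoly.irreducible hint)).2 hne)
  have hdeg : (minpoly F s).natDegree = 2 :=
    le_antisymm (hfin ▸ minpoly.natDegree_le s) ((minpoly.two_le_natDegree_iff hint).2 hsF)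
  have hc1 : (minpoly F s).coeff 1 = 0 := by
    simpa [Polynomial.coeff_derivative] using congrArg (fun p => Polynomial.coeff p 0) hder
  have hc2 : (minpoly F s).coeff 2 = 1 := hdeg ▸ (minpoly.monic hint).coeff_natDegree
  have hev := minpoly.aeval F s
  rw [Polynomial.aeval_eq_sum_range, hdeg] at hev
  simp only [Finset.sum_range_succ, Finset.sum_range_zero, hc1, hc2, zero_smul, one_smul, pow_zero,
    zero_add, add_zero, ← Algebra.algebraMap_eq_smul_one] at hev
  have hsq : s ^ 2 = algebraMap F K (-(minpoly F s).coeff 0) := by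
    rw [map_neg]; exact eq_neg_of_add_eq_zero_right hev
  refine ⟨_, s, ?_, hsq, ?_⟩
  · rintro ⟨d, hd⟩
    rw [hd, map_mul, ← pow_two, sq_eq_sq_iff_eq_or_eq_neg] at hsq
    rcases hsq with h | h
    · exact hsF ⟨d, h.symm⟩
    · exact hsF ⟨-d, by rw [map_neg, h]⟩
  · rw [LinearIndependent.pair_iff]
    intro x y hxy
    have hy : y = 0 := by
      by_contra hy
      refine hsF ⟨-(x / y), ?_⟩
      have hy' : algebraMap F K y ≠ 0 := by simpa using hy
      rw [Algebra.smul_def, Algebra.smul_def, mul_one] at hxy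
      rw [map_neg, map_div₀]
      field_simp
      linear_combination -hxy
    subst hy
    simpa [Algebra.smul_def] using hxy

open TensorProduct in
/-- If `F(√c)` splits the algebra `Q`, then `Q` contains a nonzero pair of anticommuting elements
with `p² = -c q²`. -/
theorem IsSplitBy.exists_pair {F Q K : Type*} [Field F] [Ring Q] [Algebra F Q] [Field K]
    [Algebra F K] (hK : Module.finrank F K = 2) {c : F} {s : K} (hs : s ^ 2 = algebraMap F K c)
    (hli : LinearIndependent F ![(1 : K), s]) (h : IsSplitBy F Q K) :
    ∃ p q : Q, (p ≠ 0 ∨ q ≠ 0) ∧ p * p + c • (q * q) = 0 ∧ p * q + q * p = 0 := by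
  obtain ⟨e⟩ := h
  let B := basisOfLinearIndependentOfCardEqFinrank hli (by simp [hK])
  have hB : ⇑B = ![1, s] := coe_basisOfLinearIndependentOfCardEqFinrank _ _
  -- A nonzero square-zero matrix pulls back to `1 ⊗ p + s ⊗ q`; the coordinates of its square along
  -- `1` and `s` are the two relations.
  obtain ⟨m, hm0, hm⟩ : ∃ m : Matrix (Fin 2) (Fin 2) K, m ≠ 0 ∧ m * m = 0 := by
    refine ⟨Matrix.single 0 1 1, fun h => ?_, by simp⟩
    simpa using congrFun (congrFun h 0) 1
  have hx0 : e.symm m ≠ 0 := by simpa using hm0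
  have hx : e.symm m * e.symm m = 0 := by rw [← map_mul, hm, map_zero]
  obtain ⟨f, hf⟩ := TensorProduct.eq_repr_basis_left B (e.symm m)
  rw [Finsupp.sum_fintype _ _ (by simp), Fin.sum_univ_two, hB] at hf
  simp only [Matrix.cons_val_zero, Matrix.cons_val_one] at hf
  have hprod : (1 : K) ⊗ₜ[F] (f 0 * f 0 + c • (f 1 * f 1)) +
      s ⊗ₜ[F] (f 0 * f 1 + f 1 * f 0) = 0 := by
    rw [← hx, ← hf]
    simp only [add_mul, mul_add, Algebra.TensorProduct.tmul_mul_tmul, one_mul, mul_one,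
      TensorProduct.tmul_add, TensorProduct.tmul_smul]
    rw [← pow_two s, hs, Algebra.algebraMap_eq_smul_one, TensorProduct.smul_tmul']
    abel
  refine ⟨f 0, f 1, ?_, ?_⟩
  · by_contra! h0
    rw [h0.1, h0.2, tmul_zero, tmul_zero, add_zero] at hf
    exact hx0 hf.symm
  · have := TensorProduct.sum_tmul_basis_left_eq_zero B
      (Finsupp.equivFunOnFinite.symm ![f 0 * f 0 + c • (f 1 * f 1), f 0 * f 1 + f 1 * f 0])
      (by
        rw [Finsupp.sum_fintype _ _ (by simp), Fin.sum_univ_two, hB]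
        simpa using hprod)
    exact ⟨by simpa using DFunLike.congr_fun this 0, by simpa using DFunLike.congr_fun this 1⟩

/-! ### Reduced norms and square roots of scalars -/

namespace QuatSymbol

variable {F : Type*} [Field F] [CharP F 2] {b : Fˣ} {a : F}

/-- The reduced norm of `(b, a]`. -/
def norm (q : QuatSymbol b a) : F :=
  q.re ^ 2 + q.re * q.imI + a * q.imI ^ 2 + b * (q.imJ ^ 2 + q.imJ * q.imK + a * q.imK ^ 2)

/-- The conjugate for the reduced norm of `(b, a]`. -/
def conj (q : QuatSymbol b a) : QuatSymbol b a := ⟨q.re + q.imI, q.imI, q.imJ, q.imK⟩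

theorem mul_conj (q : QuatSymbol b a) : q * conj q = algebraMap F _ (norm q) := by
  have two : (2 : F) = 0 := CharTwo.two_eq_zero
  ext <;> simp [conj, norm, QuaternionAlgebra.algebraMap_eq] <;> grind

theorem conj_mul (q : QuatSymbol b a) : conj q * q = algebraMap F _ (norm q) := by
  have two : (2 : F) = 0 := CharTwo.two_eq_zero
  ext <;> simp [conj, norm, QuaternionAlgebra.algebraMap_eq] <;> grind

theorem mul_self (q : QuatSymbol b a) : q * q = q.imI • q + algebraMap F _ (norm q) := by
  have two : (2 : F) = 0 := CharTwo.two_eq_zero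
  ext <;> simp [norm, QuaternionAlgebra.algebraMap_eq] <;> grind

/-- A square root of a scalar in a quaternion algebra gives a representation of the scalar by the
pure part of the norm form. -/
theorem represented_of_mul_self {c : F} {t : QuatSymbol b a} (h : t * t = algebraMap F _ c) :
    c = t.re ^ 2 + b * (t.imJ ^ 2 + t.imJ * t.imK + a * t.imK ^ 2) := by
  rw [mul_self] at h
  -- The `x`-coordinate of `t * t` is `t.imI ^ 2`, while that of a scalar is zero.
  have hI : t.imI = 0 := by
    simpa [QuaternionAlgebra.algebraMap_eq] using congrArg QuaternionAlgebra.imI h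
  have hre := congrArg QuaternionAlgebra.re h
  simp [QuaternionAlgebra.algebraMap_eq, hI, norm] at hre
  exact hre.symm

/-- Anisotropy makes `q` invertible; in characteristic 2 the relations say that `p` and `q` commute
and `p² = c q²`, so `p q⁻¹` is a square root of `c`. -/
theorem represented_of_pair (haniso : ∀ q : QuatSymbol b a, norm q = 0 → q = 0) {c : F}
    {p q : QuatSymbol b a} (h0 : p ≠ 0 ∨ q ≠ 0) (h₁ : p * p + c • (q * q) = 0)
    (h₂ : p * q + q * p = 0) :
    ∃ u w z : F, c = u ^ 2 + b * (w ^ 2 + w * z + a * z ^ 2) := by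
  have neg : ∀ x y : QuatSymbol b a, x + y = 0 → x = y := fun x y hxy => by
    have : y + y = 0 := by rw [← two_smul F y, CharTwo.two_eq_zero, zero_smul]
    rw [eq_neg_of_add_eq_zero_left hxy, eq_comm]; exact eq_neg_of_add_eq_zero_left this
  have hq : norm q ≠ 0 := fun hq => by
    have hq0 := haniso q hq
    have hp : p ≠ 0 := h0.resolve_right (not_not.2 hq0)
    have hn : norm p ≠ 0 := fun h => hp (haniso p h)
    rw [hq0, mul_zero, smul_zero, add_zero] at h₁
    have := congrArg (fun x => conj p * x) h₁
    simp only [← mul_assoc, conj_mul, mul_zero, ← Algebra.smul_def] at this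
    exact hp ((smul_eq_zero.1 this).resolve_left hn)
  let r : QuatSymbol b a := (norm q)⁻¹ • conj q
  have hqr : q * r = 1 := by
    rw [mul_smul_comm, mul_conj, Algebra.algebraMap_eq_smul_one, smul_smul, inv_mul_cancel₀ hq,
      one_smul]
  have hrq : r * q = 1 := by
    rw [smul_mul_assoc, conj_mul, Algebra.algebraMap_eq_smul_one, smul_smul, inv_mul_cancel₀ hq,
      one_smul]
  have hrp : r * p = p * r := by
    calc r * p = r * (p * q) * r := by rw [mul_assoc, mul_assoc, hqr, mul_one]
      _ = p * r := by rw [neg _ _ h₂, ← mul_assoc r, hrq, one_mul]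
  have ht : (p * r) * (p * r) = algebraMap F _ c := by
    calc (p * r) * (p * r) = p * (r * p) * r := by simp only [mul_assoc]
      _ = p * p * (r * r) := by rw [hrp]; simp only [mul_assoc]
      _ = c • (q * (q * r) * r) := by rw [neg _ _ h₁, smul_mul_assoc]; simp only [mul_assoc]
      _ = algebraMap F _ c := by rw [hqr, mul_one, hqr, Algebra.algebraMap_eq_smul_one]
  exact ⟨_, _, _, represented_of_mul_self ht⟩

theorem eq_zero_of_norm_eq_zero {Γ : Type*} [AddCommGroup Γ] [LinearOrder Γ]
    [IsOrderedAddMonoid Γ] {v : AddValuation F (WithTop Γ)} (h : SquareDominated v a (b : F))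
    (ha : v a < 0) (q : QuatSymbol b a) (hq : norm q = 0) : q = 0 := by
  have ha0 : a ≠ 0 := by rintro rfl; simp at ha
  obtain ⟨h₁, h₂, h₃, h₄⟩ := h.anisotropic ha ha0 b.ne_zero hq
  ext <;> assumption

/-- If the inseparable extension `F(√c)` splits `(b, a]`, then `c` is represented by the pure part
of the norm form. -/
theorem represented_of_isSplitBy {Γ : Type*} [AddCommGroup Γ] [LinearOrder Γ]
    [IsOrderedAddMonoid Γ] {v : AddValuation F (WithTop Γ)} (h : SquareDominated v a (b : F))
    (ha : v a < 0) {K : Type*} [Field K] [Algebra F K] (hK : Module.finrank F K = 2) {c : F}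
    {s : K} (hs : s ^ 2 = algebraMap F K c) (hli : LinearIndependent F ![(1 : K), s])
    (hsplit : IsSplitBy F (QuatSymbol b a) K) :
    ∃ u w z : F, c = u ^ 2 + b * (w ^ 2 + w * z + a * z ^ 2) := by
  obtain ⟨p, q, h0, h₁, h₂⟩ := hsplit.exists_pair hK hs hli
  exact represented_of_pair (eq_zero_of_norm_eq_zero h ha) h0 h₁ h₂

end QuatSymbol

theorem theorem5p1 {F : Type*} [Field F] [CharP F 2]
    {Γ : Type*} [AddCommGroup Γ] [LinearOrder Γ] [IsOrderedAddMonoid Γ]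
    (hΓ : Nonempty (Γ ≃+ ℤ × ℤ)) (hrank : convexRank Γ = 2)
    (v : AddValuation F (WithTop Γ)) (hv : Function.Surjective v)
    (α β : Fˣ) (hα : unitValue v α < 0) (hβ : unitValue v β < 0)
    (hαβ : LinearIndependent (ZMod 2) ![valueClass v α, valueClass v β]) :
    ¬ ∃ (K : Type*) (_ : Field K) (_ : Algebra F K), IsInsepQuadratic F K ∧
      IsSplitBy F (QuatSymbol β (α : F)) K ∧
      IsSplitBy F (QuatSymbol α (β : F)) K ∧
      IsSplitBy F (QuatSymbol β ((α : F) * (β : F))) K := by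
  rintro ⟨K, _, _, hK, hs₁, hs₂, hs₃⟩
  obtain ⟨c, s, hc, hs, hli⟩ := hK.exists_sq
  have hdom := squareDominated_of_linearIndependent hαβ
  have hα' : v (α : F) < 0 := by rw [← coe_unitValue]; exact_mod_cast hα
  have hβ' : v (β : F) < 0 := by rw [← coe_unitValue]; exact_mod_cast hβ
  have hab : v ((α : F) * (β : F)) < 0 := val_mul_neg v hα' hβ'
  obtain ⟨u₁, w₁, z₁, h₁⟩ := QuatSymbol.represented_of_isSplitBy hdom hα' hK.1 hs hli hs₁
  obtain ⟨u₂, w₂, z₂, h₂⟩ := QuatSymbol.represented_of_isSplitBy hdom.symm hβ' hK.1 hs hli hs₂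
  obtain ⟨u₃, w₃, z₃, h₃⟩ :=
    QuatSymbol.represented_of_isSplitBy hdom.mul_left hab hK.1 hs hli hs₃
  exact hc (hdom.isSquare_of_represented hα' hβ' α.ne_zero β.ne_zero h₁ h₂ h₃)
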